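/- **Notation.** Let $\mathbb K$ be a field, $\mathbb K[\mathbf x]=\mathbb K[x_1,\dots,x_n]$ and $\sigma=(\sigma_\alpha)_{\alpha\in\mathbb N^n}$ a sequence in $\mathbb K$. Put $\langle\sigma\mid p\rangle=\sum_\alpha p_\alpha\sigma_\alpha$ for $p=\sum_\alpha p_\alpha\mathbf x^\alpha$, and $\langle p,q\rangle_\sigma=\langle\sigma\mid pq\rangle$. The Hankel operator is $H_\sigma:\mathbb K[\mathbf x]\to\mathbb K[\mathbf x]^*$, $p\mapsto(q\mapsto\langle\sigma\mid pq\rangle)$, and $I_\sigma=\ker H_\sigma$ is the ideal of linear recurrence relations of $\sigma$. For $B\subset\mathbb N^n$ let $B^+=B\cup\bigcup_i(B+e_i)$ and $\partial B=B^+\setminus B$; $B$ is *connected to $1$* if $0\in B$ and every $\beta\in B\setminus\{0\}$ is $\beta'+e_i$ for some $\beta'\in B$ and some $i$. For $\mathbf a\subset\mathbb N^n$ let $\langle\mathbf x^{\mathbf a}\rangle$ be the span of the $\mathbf x^\alpha$, $\alpha\in\mathbf a$. For lists of polynomials, $\operatorname{proj}(f,[p_1,\dots,p_l],[m_1,\dots,m_l])$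 is obtained by starting with $g=f$ and replacing $g$ by $g-\langle g,m_i\rangle_\sigma\,p_i$ for $i=1,\dots,l$ in turn. **Algorithm.** The input is $(\sigma_\alpha)_{\alpha\in\mathbf a}$, where $\mathbf a$ is a finite list of exponents, connected to $1$. Start with the lists $\mathbf b=\mathbf c=\mathbf d=[\,]$, $\mathbf n=[0]$, $\mathbf s=\mathbf t=\mathbf a$. While $\mathbf n\ne\emptyset$: for each $\alpha\in\mathbf n$ in turn, let $p_\alpha=\operatorname{proj}(\mathbf x^\alpha,[p_\beta]_{\beta\in\mathbf b},[m_\beta]_{\beta\in\mathbf b})$, and look for the first $\gamma\in\mathbf t$ with $\mathbf x^\gamma p_\alpha\in\langle\mathbf x^{\mathbf a}\rangle$ and $\langle p_\alpha,\mathbf x^\gamma\rangle_\sigma\neq0$; if there is one, let $m_\alpha=\langle p_\alpha,\mathbf x^\gamma\rangle_\sigma^{-1}\mathbf x^\gamma$, append $\alpha$ to $\mathbf b$ and $\gamma$ to $\mathbf c$, and remove $\alpha$ from $\mathbf s$ and $\gamma$ from $\mathbf t$; otherwise append $\alpha$ to $\mathbf d$ and remove $\alpha$ from $\mathbf s$.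 After all $\alpha\in\mathbf n$ have been treated, replace $\mathbf n$ by the list of all $\alpha\in\partial\mathbf b\cap\mathbf s$ with $\alpha\notin\mathbf d$ and $\alpha+\mathbf c\subset\mathbf a$, in the order of $\mathbf s$. The output is $\mathbf b$, $\mathbf c$, $\mathbf d$, $(p_\beta)_{\beta\in\mathbf b}$ and the border relations $\mathbf k=[p_\alpha]_{\alpha\in\mathbf d}$. **Lemma.** Let $\prec$ be a monomial ordering on $\mathbb N^n$, and assume that it is the order of the algorithm: the list $\mathbf a$ is strictly increasing for $\prec$, and the exponents treated in the successive loops form a strictly increasing sequence for $\prec$. Assume that at the end of the algorithm $\mathbf d=\partial\mathbf b$ (as sets), and that there is $\mathbf b'\subset\mathbb N^n$ connected to $1$ with $\mathbf c^+\subset\mathbf b'$ and $\mathbf b^++\mathbf b'=\mathbf a$ (as sets). Put $r=|\mathbf b|$. Then 1. $\mathbf b=\mathbf c$ as sets of exponents; 2. there is exactly one sequence $\tilde\sigma\in\mathbb K^{\mathbb N^n}$ that coincides with $\sigma$ on $\langle\mathbf x^{\mathbf a}\rangle$ and satisfies $\operatorname{rank}H_{\tilde\sigma}=r$; 3. $\mathbf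 k$ is a Gröbner basis of the ideal $I_{\tilde\sigma}$ for $\prec$: $\mathbf k\subset I_{\tilde\sigma}$, and the leading terms of the elements of $\mathbf k$ generate the ideal generated by the leading terms of the elements of $I_{\tilde\sigma}$. In particular, if $\operatorname{rank}H_\sigma=r$, then $\mathbf k$ is a Gröbner basis of $I_\sigma$. -/

import Mathlib

open MvPolynomial
open scoped MonomialOrder Pointwise

noncomputable section

namespace HankelBB

/-! ### Exponent sets -/

/-- Exponents `α ∈ ℕⁿ`; `α` stands for the monomial `x^α`. -/
abbrev Expo (n : ℕ) := Fin n →₀ ℕ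

/-- `B⁺ = B ∪ x₁ B ∪ ⋯ ∪ xₙ B`. -/
def plus {n : ℕ} (B : Set (Expo n)) : Set (Expo n) :=
  B ∪ {α | ∃ i : Fin n, ∃ β ∈ B, α = β + Finsupp.single i 1}

/-- The border `∂B = B⁺ \ B`. -/
def border {n : ℕ} (B : Set (Expo n)) : Set (Expo n) :=
  plus B \ B

/-- `B` is connected to `1`: it contains `1`, and every other element of `B` is a variable times
an element of `B`. -/
def ConnectedToOne {n : ℕ} (B : Set (Expo n)) : Prop :=
  0 ∈ B ∧ ∀ β ∈ B, β ≠ 0 → ∃ β' ∈ B, ∃ i : Fin n, β = β' + Finsupp.single i 1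

/-! ### Sequences as linear forms, Hankel operators, recurrence ideals -/

section Hankel

variable {n : ℕ} {K : Type*} [Field K]

/-- The linear form `p ↦ ⟨σ | p⟩ = ∑ p_α σ_α` of a sequence `σ = (σ_α)_{α ∈ ℕⁿ}`. -/
def pairing (σ : Expo n → K) : MvPolynomial (Fin n) K →ₗ[K] K :=
  (basisMonomials (Fin n) K).constr K σ

/-- `⟨p, q⟩_σ = ⟨σ | p q⟩`. -/
def innerProd (σ : Expo n → K) (p q : MvPolynomial (Fin n) K) : K :=
  pairing σ (p * q)

/-- The Hankel operator `H_σ : K[x] → K[x]^*`, `p ↦ p ⋆ σ = (q ↦ ⟨σ | p q⟩)`. -/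
def hankel (σ : Expo n → K) :
    MvPolynomial (Fin n) K →ₗ[K] Module.Dual K (MvPolynomial (Fin n) K) :=
  (LinearMap.mul K (MvPolynomial (Fin n) K)).compr₂ (pairing σ)

theorem hankel_apply (σ : Expo n → K) (p q : MvPolynomial (Fin n) K) :
    hankel σ p q = pairing σ (p * q) := rfl

/-- The ideal `I_σ = ker H_σ` of linear recurrence relations of `σ`. -/
def recIdeal (σ : Expo n → K) : Ideal (MvPolynomial (Fin n) K) where
  carrier := {p | hankel σ p = 0}
  add_mem' := by
    intro p q hp hq
    simp only [Set.mem_ofPred_eq] at hp hq ⊢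
    rw [map_add, hp, hq, add_zero]
  zero_mem' := by simp
  smul_mem' := by
    intro c p hp
    simp only [Set.mem_ofPred_eq] at hp ⊢
    refine LinearMap.ext fun q => ?_
    have h := LinearMap.congr_fun hp (c * q)
    rw [hankel_apply] at h ⊢
    rw [smul_eq_mul, mul_assoc, mul_left_comm]
    simpa using h

/-- `⟨x^a⟩`, the vector space spanned by the monomials with exponents in `a`. -/
def monomialSpan (K : Type*) [Field K] (a : Set (Expo n)) :
    Submodule K (MvPolynomial (Fin n) K) :=
  Submodule.span K ((fun α => monomial α (1 : K)) '' a)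

/-- `G` is a Gröbner basis of the ideal `I` for the monomial ordering `m`: `G ⊆ I`, and the leading
terms of `G` generate the ideal generated by the leading terms of the elements of `I`. -/
def IsGroebnerBasis (m : MonomialOrder (Fin n)) (G : Set (MvPolynomial (Fin n) K))
    (I : Ideal (MvPolynomial (Fin n) K)) : Prop :=
  G ⊆ (I : Set (MvPolynomial (Fin n) K)) ∧
    Ideal.span (m.leadingTerm '' G) =
      Ideal.span (m.leadingTerm '' (I : Set (MvPolynomial (Fin n) K)))

end Hankel

/-! ### The border basis algorithm -/

section Algorithm

variable {n : ℕ} {K : Type*} [Field K]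

/-- `proj(f, [p₁, …, p_l], [m₁, …, m_l])`: start with `g = f`, and for `i = 1, …, l` replace `g` by
`g - ⟨g, m_i⟩_σ p_i`. The two lists are given as one list of pairs `(p_i, m_i)`. -/
def proj (σ : Expo n → K) (f : MvPolynomial (Fin n) K)
    (pm : List (MvPolynomial (Fin n) K × MvPolynomial (Fin n) K)) : MvPolynomial (Fin n) K :=
  pm.foldl (fun g x => g - innerProd σ g x.2 • x.1) f

/-- The variables of the algorithm. All lists are lists of exponents, and `todo` is
the list written `n` in the pseudo-code; `p α` and `m α` are the
polynomial `p_α` and the scaled monomial `m_α` once they have been assigned. The field `treated`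
records the exponents in the order in which the algorithm treats them. -/
structure State (n : ℕ) (K : Type*) [Field K] where
  b : List (Expo n)
  c : List (Expo n)
  d : List (Expo n)
  todo : List (Expo n)
  s : List (Expo n)
  t : List (Expo n)
  p : Expo n → MvPolynomial (Fin n) K
  m : Expo n → MvPolynomial (Fin n) K
  treated : List (Expo n)

/-- The border relations `k = [p_α]_{α ∈ d}`. -/
def State.k (S : State n K) : List (MvPolynomial (Fin n) K) := S.d.map S.p

/-- `b = c = d = []`, `todo = [0]`, `s = t = a`. -/
def init (a : List (Expo n)) : State n K where
  b := []
  c := []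
  d := []
  todo := [0]
  s := a
  t := a
  p := fun _ => 0
  m := fun _ => 0
  treated := []

open scoped Classical in
/-- `next(b, d, c, s)`: the exponents `α ∈ ∂b ∩ s` that are not in `d` and satisfy `α + c ⊆ a`,
in the order of the list `s`. -/
def next (a b d c s : List (Expo n)) : List (Expo n) :=
  s.filter fun α =>
    decide (α ∈ border {β | β ∈ b} ∧ α ∉ d ∧ ∀ γ ∈ c, α + γ ∈ a)

open scoped Classical in
/-- The first `γ` in the list `t` with `x^γ p ∈ ⟨x^a⟩` and `⟨p, x^γ⟩_σ ≠ 0`, if there is one. -/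
def firstPivot (σ : Expo n → K) (a t : List (Expo n)) (p : MvPolynomial (Fin n) K) :
    Option (Expo n) :=
  t.find? fun γ =>
    decide (monomial γ 1 * p ∈ monomialSpan K {α | α ∈ a} ∧ innerProd σ p (monomial γ 1) ≠ 0)

/-- The body of the inner loop: the treatment of one exponent `α ∈ todo`. -/
def treat (σ : Expo n → K) (a : List (Expo n)) (S : State n K) (α : Expo n) : State n K :=
  let pα := proj σ (monomial α 1) (S.b.map fun β => (S.p β, S.m β))
  match firstPivot σ a S.t pα with
  | some γ =>
    { S with
      p := Function.update S.p α pα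
      m := Function.update S.m α ((innerProd σ pα (monomial γ 1))⁻¹ • monomial γ 1)
      b := S.b ++ [α]
      s := S.s.erase α
      c := S.c ++ [γ]
      t := S.t.erase γ
      treated := S.treated ++ [α] }
  | none =>
    { S with
      p := Function.update S.p α pα
      d := S.d ++ [α]
      s := S.s.erase α
      treated := S.treated ++ [α] }

/-- The body of the outer loop: treat the elements of `todo` one after the other, then compute the
new list `todo`. -/
def loop (σ : Expo n → K) (a : List (Expo n)) (S : State n K) : State n K :=
  let S' := S.todo.foldl (treat σ a) S
  { S' with todo := next a S'.b S'.d S'.c S'.s }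

/-- `S` is the final state of the algorithm on the input `(σ_α)_{α ∈ a}`: it is obtained from the
initial state by executing the outer loop while `todo ≠ []`, and `todo = []` holds in `S`. The list `a`
carries the order in which the algorithm goes through the exponents. -/
def IsOutput (σ : Expo n → K) (a : List (Expo n)) (S : State n K) : Prop :=
  Relation.ReflTransGen (fun T T' => T.todo ≠ [] ∧ T' = loop σ a T) (init a) S ∧ S.todo = []

/-- The order of the algorithm is the monomial ordering `m`: the list `a`, in whose order the
candidates for `todo` and for the pivots `γ` are examined, is strictly increasing for `m`, and so is
the sequence of the exponents treated in all the loops of the run that ends in `S`. -/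
def OrderIs (m : MonomialOrder (Fin n)) (a : List (Expo n)) (S : State n K) : Prop :=
  a.Pairwise (fun α β => α ≺[m] β) ∧ S.treated.Pairwise (fun α β => α ≺[m] β)

/-- `τ` coincides with `σ` on `⟨x^a⟩` and `H_τ` has rank `r`. -/
def IsFlatExtension (σ : Expo n → K) (a : List (Expo n)) (r : ℕ) (τ : Expo n → K) : Prop :=
  (∀ p ∈ monomialSpan K {α | α ∈ a}, pairing τ p = pairing σ p) ∧ (hankel τ).rank = (r : Cardinal)

end Algorithm

end HankelBB

end

open MvPolynomial
open scoped MonomialOrder Pointwise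

noncomputable section

namespace HankelBB

variable {n : ℕ} {K : Type*} [Field K]

/-! ### Spans of monomials -/

/-! The run is a Gram–Schmidt process. The `p β`, `β ∈ b`, are unitriangular in the monomials of
`b`, and their pairing with the pivots `c` is triangular with nonzero diagonal; so `⟨x^b⟩` and
`⟨x^c⟩` are in perfect duality. Since `b⁺ + b' = a`, every product the search needs has support in
`a`. Hence a failed search means that `p α` is orthogonal to all of `x^(b')`, and each pivot is the
smallest element of `b'` that pairs nontrivially with its `p β` (`IsOutput.isFlatPivoting`).

Existence. Let `N` project onto `⟨x^b⟩` along the polynomials orthogonal to `x^c`. On `⟨x^(b⁺)⟩` it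
preserves pairings with `x^(b')`. Because `c⁺ ⊆ b'`, the operators `v ↦ N (X i * v)` commute, so
`⟨x^b⟩` becomes a module over the polynomial ring, and `f ↦ ⟨σ | f · 1⟩`, where `f · 1` is the
module action, is the extension `τ` (`exists_flat_extension`). The rank condition says that `⟨x^b⟩`
is a complement of `I_τ` (`rank_hankel_eq_iff`).

Uniqueness and Gröbner basis. In any such extension the border relations are recurrences. They
rewrite every monomial into monomials of `b` that are no larger, so `b` is the set of standard
monomials of `I_τ`, and `τ` is determined by its values on `⟨x^b⟩`. A leading exponent of an element
of `I_τ` lies outside `b`, hence is divisible by some `α ∈ d`, the leading exponent of `p α`.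

Equality `b = c`. Minimality of the pivots gives the same rewriting with `c` in place of `b`
(`monomial_mem_sup_pivots`). A standard monomial cannot be rewritten into strictly smaller ones, so
`b ⊆ c`, and the two lists have the same length. -/

theorem monomialSpan_eq_restrictSupport (A : Set (Expo n)) :
    monomialSpan K A = restrictSupport K A := (restrictSupport_eq_span K A).symm

theorem mem_monomialSpan {A : Set (Expo n)} {f : MvPolynomial (Fin n) K} :
    f ∈ monomialSpan K A ↔ ↑f.support ⊆ A := by
  rw [monomialSpan_eq_restrictSupport, mem_restrictSupport_iff]

theorem monomial_mem_monomialSpan {A : Set (Expo n)} {α : Expo n} (h : α ∈ A) :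
    monomial α (1 : K) ∈ monomialSpan K A :=
  Submodule.subset_span ⟨α, h, rfl⟩

theorem monomialSpan_mono {A B : Set (Expo n)} (h : A ⊆ B) :
    monomialSpan K A ≤ monomialSpan K B :=
  Submodule.span_mono (Set.image_mono h)

theorem monomialSpan_le {A : Set (Expo n)} {W : Submodule K (MvPolynomial (Fin n) K)}
    (h : ∀ α ∈ A, monomial α (1 : K) ∈ W) : monomialSpan K A ≤ W := by
  rw [monomialSpan, Submodule.span_le]
  rintro _ ⟨α, hα, rfl⟩
  exact h α hα

theorem monomial_mul_mem_monomialSpan {A B : Set (Expo n)} {γ : Expo n}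
    (h : ∀ α ∈ A, α + γ ∈ B) {f : MvPolynomial (Fin n) K} (hf : f ∈ monomialSpan K A) :
    monomial γ 1 * f ∈ monomialSpan K B := by
  have : monomialSpan K A ≤ (monomialSpan K B).comap
      (LinearMap.mulLeft K (monomial γ (1 : K))) := by
    refine monomialSpan_le fun α hα => ?_
    rw [Submodule.mem_comap, LinearMap.mulLeft_apply, monomial_mul, one_mul, add_comm]
    exact monomial_mem_monomialSpan (h α hα)
  exact this hf

theorem finrank_monomialSpan {b : List (Expo n)} (hb : b.Nodup) :
    Module.finrank K (monomialSpan K {β | β ∈ b}) = b.length := by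
  classical
  rw [monomialSpan_eq_restrictSupport,
    Module.finrank_eq_nat_card_basis (basisRestrictSupport K {β | β ∈ b}),
    ← List.toFinset_card_of_nodup hb, ← Nat.card_eq_finsetCard]
  simp

theorem finite_monomialSpan (b : List (Expo n)) :
    Module.Finite K (monomialSpan K {β | β ∈ b}) :=
  Module.Finite.span_of_finite K ((List.finite_toSet b).image _)

theorem monomial_add_single (γ : Expo n) (i : Fin n) :
    (monomial (γ + Finsupp.single i 1) (1 : K)) = X i * monomial γ 1 := by
  rw [X, monomial_mul, one_mul, add_comm]

theorem X_mul_mem_monomialSpan_plus {A : Set (Expo n)} (i : Fin n) {f : MvPolynomial (Fin n) K}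
    (hf : f ∈ monomialSpan K A) : X i * f ∈ monomialSpan K (plus A) :=
  monomial_mul_mem_monomialSpan (fun α hα => Or.inr ⟨i, α, hα, rfl⟩) hf

theorem subset_plus (A : Set (Expo n)) : A ⊆ plus A := Set.subset_union_left

theorem add_single_mem_plus {A : Set (Expo n)} {α : Expo n} (h : α ∈ A) (i : Fin n) :
    α + Finsupp.single i 1 ∈ plus A := Or.inr ⟨i, α, h, rfl⟩

theorem mem_or_mem_border_of_mem_plus {A : Set (Expo n)} {α : Expo n} (h : α ∈ plus A) :
    α ∈ A ∨ α ∈ border A := by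
  by_cases hα : α ∈ A
  · exact Or.inl hα
  · exact Or.inr ⟨h, hα⟩

theorem zero_notMem_border (A : Set (Expo n)) : (0 : Expo n) ∉ border A := by
  rintro ⟨h | ⟨i, β, -, h⟩, h'⟩
  · exact h' h
  · have := DFunLike.congr_fun h i
    simp at this

theorem expo_induction {P : Expo n → Prop} (zero : P 0)
    (add_single : ∀ α (i : Fin n), P α → P (α + Finsupp.single i 1)) (α : Expo n) : P α := by
  induction α using Finsupp.induction with
  | zero => exact zero
  | single_add i k f _ _ ih =>
    clear * - ih add_single
    induction k with
    | zero => simpa using ih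
    | succ k ihk =>
      rw [Finsupp.single_add, add_right_comm]
      exact add_single _ i ihk

/-- Induction along a set that is connected to `1`. -/
theorem ConnectedToOne.induction {B : Set (Expo n)} (hB : ConnectedToOne B) {P : Expo n → Prop}
    (zero : P 0)
    (add_single : ∀ β ∈ B, ∀ i : Fin n, β + Finsupp.single i 1 ∈ B → P β →
      P (β + Finsupp.single i 1)) : ∀ β ∈ B, P β := by
  intro β
  induction h : β.degree using Nat.strong_induction_on generalizing β with
  | _ d ih =>
    intro hβ
    by_cases h0 : β = 0
    · exact h0 ▸ zero
    obtain ⟨β', hβ', i, rfl⟩ := hB.2 β hβ h0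
    refine add_single β' hβ' i hβ (ih β'.degree ?_ β' rfl hβ')
    rw [← h, map_add, Finsupp.degree_single]
    exact Nat.lt_succ_self _

/-! ### The Hankel form -/

theorem hankel_comm (σ : Expo n → K) (p q : MvPolynomial (Fin n) K) :
    hankel σ p q = hankel σ q p := by
  rw [hankel_apply, hankel_apply, mul_comm]

theorem hankel_mul_left (σ : Expo n → K) (p q r : MvPolynomial (Fin n) K) :
    hankel σ (p * q) r = hankel σ q (p * r) := by
  rw [hankel_apply, hankel_apply, ← mul_assoc, mul_comm p q]

theorem pairing_monomial (σ : Expo n → K) (α : Expo n) : pairing σ (monomial α 1) = σ α := by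
  have := (basisMonomials (Fin n) K).constr_basis K σ α
  rwa [coe_basisMonomials] at this

theorem mem_recIdeal {σ : Expo n → K} {f : MvPolynomial (Fin n) K} :
    f ∈ recIdeal σ ↔ hankel σ f = 0 := Iff.rfl

theorem hankel_eq_zero_of_mem_monomialSpan {σ : Expo n → K} {A : Set (Expo n)}
    {f g : MvPolynomial (Fin n) K} (hg : g ∈ monomialSpan K A)
    (h : ∀ α ∈ A, hankel σ f (monomial α 1) = 0) : hankel σ f g = 0 := by
  have : monomialSpan K A ≤ LinearMap.ker (hankel σ f) := monomialSpan_le h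
  exact this hg

/-! ### Algebra maps from commuting families -/

-- `aeval` needs a commutative target; the subalgebra generated by a commuting family is one.
open scoped IsMulCommutative in
theorem exists_algHom_of_commute {A : Type*} [Ring A] [Algebra K A] (M : Fin n → A)
    (hM : ∀ i j, M i * M j = M j * M i) :
    ∃ Φ : MvPolynomial (Fin n) K →ₐ[K] A, ∀ i, Φ (X i) = M i := by
  have hcomm : ∀ x ∈ Set.range M, ∀ y ∈ Set.range M, x * y = y * x := by
    rintro _ ⟨i, rfl⟩ _ ⟨j, rfl⟩
    exact hM i j
  have := Algebra.isMulCommutative_adjoin K hcomm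
  refine ⟨(Algebra.adjoin K (Set.range M)).val.comp
    (aeval fun i =>
    (⟨M i, Algebra.subset_adjoin ⟨i, rfl⟩⟩ : Algebra.adjoin K (Set.range M))), fun i => ?_⟩
  simp

/-! ### Flat extensions -/

/-- A form on `⟨x^(B⁺ + B')⟩` whose products with `x^(B')` factor through a projection `N` onto `⟨x^B⟩`
extends to a form on all polynomials for which `⟨x^B⟩` and the recurrence ideal together span
everything. -/
theorem exists_flat_extension {σ : Expo n → K} {B C B' : Set (Expo n)}
    (hB : ConnectedToOne B) (hB' : ConnectedToOne B') (hC : plus C ⊆ B')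
    (N : MvPolynomial (Fin n) K →ₗ[K] MvPolynomial (Fin n) K)
    (hN_mem : ∀ f, N f ∈ monomialSpan K B) (hN_id : ∀ f ∈ monomialSpan K B, N f = f)
    (hN : ∀ f ∈ monomialSpan K (plus B), ∀ γ ∈ B',
      hankel σ (N f) (monomial γ 1) = hankel σ f (monomial γ 1))
    (hnd : ∀ f ∈ monomialSpan K B, (∀ γ ∈ C, hankel σ f (monomial γ 1) = 0) → f = 0) :
    ∃ τ : Expo n → K,
      (∀ f ∈ monomialSpan K (plus B), ∀ γ ∈ B',
        hankel τ f (monomial γ 1) = hankel σ f (monomial γ 1)) ∧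
      ∀ f, ∃ v ∈ monomialSpan K B, f - v ∈ recIdeal τ := by
  let V := monomialSpan K B
  let M : Fin n → Module.End K V := fun i =>
    (N ∘ₗ LinearMap.mulLeft K (X i) ∘ₗ V.subtype).codRestrict V fun v => hN_mem _
  have M_coe : ∀ i (v : V), (M i v : MvPolynomial (Fin n) K) = N (X i * (v : MvPolynomial (Fin n) K)) := fun i v => rfl
  -- Both applications of `N` can be undone: the outer one against `γ`, the inner one against `γ +
  -- e_i`, which lies in `C⁺ ⊆ B'`. What remains is symmetric in `i` and `j`.
  have key : ∀ i j (v : V) γ, γ ∈ C → hankel σ (M i (M j v) : MvPolynomial (Fin n) K)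
      (monomial γ 1) = hankel σ (X i * (X j * (v : MvPolynomial (Fin n) K))) (monomial γ 1) := by
    intro i j v γ hγ
    rw [M_coe, hN _ (X_mul_mem_monomialSpan_plus i (M j v).2) γ (hC (subset_plus _ hγ)),
      hankel_mul_left, ← monomial_add_single, M_coe,
      hN _ (X_mul_mem_monomialSpan_plus j v.2) _ (hC (add_single_mem_plus hγ i)),
      monomial_add_single, ← hankel_mul_left]
  have hM : ∀ i j, M i * M j = M j * M i := by
    intro i j
    refine LinearMap.ext fun v => Subtype.ext ?_
    rw [← sub_eq_zero]
    refine hnd _ (V.sub_mem (M i (M j v)).2 (M j (M i v)).2) fun γ hγ => ?_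
    rw [map_sub, LinearMap.sub_apply, sub_eq_zero]
    refine (key i j v γ hγ).trans ((key j i v γ hγ).trans ?_).symm
    rw [mul_left_comm]
  obtain ⟨Φ, hΦ⟩ := exists_algHom_of_commute (K := K) M hM
  -- The polynomial `1` as an element of the module `V`; `Φ f e` is the normal form of `f`.
  let e : V := ⟨monomial 0 1, monomial_mem_monomialSpan hB.1⟩
  have Φ_single : ∀ γ i, Φ (monomial (γ + Finsupp.single i 1) 1) = M i * Φ (monomial γ 1) := by
    intro γ i
    rw [monomial_add_single, map_mul, hΦ]
  have Φ_monomial : ∀ β ∈ B, (Φ (monomial β 1) e : MvPolynomial (Fin n) K) = monomial β 1 := by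
    refine hB.induction ?_ fun β hβ i hβi ih => ?_
    · rw [show (monomial (0 : Expo n) (1 : K)) = 1 from rfl, map_one]
      rfl
    · rw [Φ_single, Module.End.mul_apply, M_coe, ih, ← monomial_add_single]
      exact hN_id _ (monomial_mem_monomialSpan hβi)
  let L : MvPolynomial (Fin n) K →ₗ[K] MvPolynomial (Fin n) K :=
    V.subtype ∘ₗ LinearMap.applyₗ e ∘ₗ Φ.toLinearMap
  have L_apply : ∀ f, L f = (Φ f e : MvPolynomial (Fin n) K) := fun f => rfl
  have L_id : ∀ v ∈ V, L v = v := by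
    have : V ≤ LinearMap.eqLocus L LinearMap.id := monomialSpan_le fun β hβ => Φ_monomial β hβ
    exact fun v hv => this hv
  have L_eq : ∀ f ∈ monomialSpan K (plus B), L f = N f := by
    have : monomialSpan K (plus B) ≤ LinearMap.eqLocus L N := by
      refine monomialSpan_le ?_
      rintro α (hα | ⟨i, β, hβ, rfl⟩)
      · have := monomial_mem_monomialSpan (K := K) hα
        exact (L_id _ this).trans (hN_id _ this).symm
      · change L _ = N _
        rw [L_apply, Φ_single, Module.End.mul_apply, M_coe, Φ_monomial β hβ, monomial_add_single]
    exact fun f hf => this hf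
  let τ : Expo n → K := fun α => pairing σ (L (monomial α 1))
  have hτ : ∀ f, pairing τ f = pairing σ (L f) := by
    have : pairing τ = pairing σ ∘ₗ L := (basisMonomials (Fin n) K).ext fun α => by
      rw [coe_basisMonomials, pairing_monomial]
      rfl
    exact fun f => LinearMap.congr_fun this f
  have hσ : ∀ γ ∈ B', ∀ w : V,
      pairing σ (Φ (monomial γ 1) w : MvPolynomial (Fin n) K) = hankel σ w (monomial γ 1) := by
    -- The new variable is made to act first, so that the induction hypothesis for `γ` is used at
    -- the vector `M i w`.
    refine hB'.induction ?_ fun γ hγ i hγi ih => ?_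
    · intro w
      rw [show (monomial (0 : Expo n) (1 : K)) = 1 from rfl, map_one, hankel_apply, mul_one]
      rfl
    · intro w
      rw [monomial_add_single, mul_comm, map_mul, hΦ, Module.End.mul_apply, ih, M_coe,
        hN _ (X_mul_mem_monomialSpan_plus i w.2) γ hγ, hankel_mul_left, mul_comm]
  refine ⟨τ, fun f hf γ hγ => ?_, fun f => ⟨L f, (Φ f e).2, ?_⟩⟩
  · rw [hankel_apply, hτ, L_apply, mul_comm, map_mul, Module.End.mul_apply, hσ γ hγ, ← L_apply,
      L_eq f hf, hN f hf γ hγ]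
  · rw [mem_recIdeal]
    refine LinearMap.ext fun g => ?_
    -- A polynomial and its normal form act alike on `1`, hence so do their products with any `g`.
    have : Φ (f - L f) e = 0 := Subtype.ext <| by
      rw [← L_apply, map_sub, L_id (L f) (Φ f e).2, sub_self]
      rfl
    rw [hankel_apply, hτ, L_apply, mul_comm, map_mul, Module.End.mul_apply, this, map_zero]
    simp

/-- If `⟨x^b⟩` meets `I_τ` trivially, then `⟨x^b⟩` is a complement of `I_τ` exactly when `H_τ` has rank
`|b|`. -/
theorem rank_hankel_eq_iff {τ : Expo n → K} {b : List (Expo n)} (hb : b.Nodup)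
    (hV : ∀ f ∈ monomialSpan K {β | β ∈ b}, f ∈ recIdeal τ → f = 0) :
    (hankel τ).rank = (b.length : Cardinal) ↔
      ∀ f, ∃ v ∈ monomialSpan K {β | β ∈ b}, f - v ∈ recIdeal τ := by
  have := finite_monomialSpan (K := K) b
  set V := monomialSpan K {β | β ∈ b} with hVdef
  have hinj : Function.Injective ((hankel τ).domRestrict V) := by
    rw [← LinearMap.ker_eq_bot, LinearMap.ker_eq_bot']
    exact fun v hv => Subtype.ext (hV v v.2 hv)
  have hfr : Module.finrank K (V.map (hankel τ)) = b.length := by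
    rw [← LinearMap.range_domRestrict, LinearMap.finrank_range_of_inj hinj, finrank_monomialSpan hb]
  have hrank : Module.rank K (V.map (hankel τ)) = (b.length : Cardinal) := by
    rw [← hfr, Module.finrank_eq_rank]
  constructor
  · intro h f
    have hfin : Module.Finite K (LinearMap.range (hankel τ)) := by
      have : Module.Free K (LinearMap.range (hankel τ)) := 
        Module.Free.of_divisionRing K (LinearMap.range (hankel τ))
      exact Module.rank_lt_aleph0_iff.1 (h.trans_lt Cardinal.natCast_lt_aleph0)
    -- The image of `V` already has dimension `|b|`, so a range of dimension `|b|` cannot exceed it.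
    have heq : V.map (hankel τ) = LinearMap.range (hankel τ) := by
      refine Submodule.eq_of_le_of_finrank_eq (LinearMap.map_le_range) ?_
      rw [hfr]
      exact (Module.finrank_eq_of_rank_eq h).symm
    obtain ⟨v, hv, hvf⟩ : hankel τ f ∈ V.map (hankel τ) := heq ▸ LinearMap.mem_range_self _ f
    exact ⟨v, hv, by rw [mem_recIdeal, map_sub, hvf, sub_self]⟩
  · intro h
    have heq : V.map (hankel τ) = LinearMap.range (hankel τ) := by
      refine le_antisymm LinearMap.map_le_range ?_
      rintro _ ⟨f, rfl⟩
      obtain ⟨v, hv, hvf⟩ := h f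
      rw [mem_recIdeal, map_sub, sub_eq_zero] at hvf
      exact ⟨v, hv, hvf.symm⟩
    rw [LinearMap.rank, ← heq, hrank]

theorem sup_monomialSpan_mono (I : Submodule K (MvPolynomial (Fin n) K)) {A B : Set (Expo n)}
    (h : A ⊆ B) : I ⊔ monomialSpan K A ≤ I ⊔ monomialSpan K B :=
  sup_le_sup le_rfl (monomialSpan_mono h)

/-! ### Reduction by smaller monomials -/

/-- If the monomials of `B⁺` reduce modulo `I` to smaller monomials of `B`, then so do all. -/
theorem monomial_mem_sup_of_forall_plus (m : MonomialOrder (Fin n))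
    {I : Ideal (MvPolynomial (Fin n) K)} {B : Set (Expo n)}
    (h0 : monomial 0 (1 : K) ∈ I.restrictScalars K ⊔ monomialSpan K {β ∈ B | β ≼[m] 0})
    (h : ∀ α ∈ plus B, monomial α (1 : K) ∈
      I.restrictScalars K ⊔ monomialSpan K {β ∈ B | β ≼[m] α}) (α : Expo n) :
    monomial α (1 : K) ∈ I.restrictScalars K ⊔ monomialSpan K {β ∈ B | β ≼[m] α} := by
  induction α using expo_induction with
  | zero => exact h0
  | add_single α i ih =>
    obtain ⟨f, hf, v, hv, hfv⟩ := Submodule.mem_sup.1 ih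
    rw [monomial_add_single, ← hfv, mul_add]
    refine add_mem (Submodule.mem_sup_left (I.mul_mem_left _ hf)) ?_
    have : monomialSpan K {β ∈ B | β ≼[m] α} ≤ (I.restrictScalars K ⊔
        monomialSpan K {β ∈ B | β ≼[m] α + Finsupp.single i 1}).comap
          (LinearMap.mulLeft K (X i)) := by
      refine monomialSpan_le fun β hβ => ?_
      rw [Submodule.mem_comap, LinearMap.mulLeft_apply, ← monomial_add_single]
      refine sup_monomialSpan_mono _ ?_ (h _ (add_single_mem_plus hβ.1 i))
      refine fun δ hδ => ⟨hδ.1, hδ.2.trans ?_⟩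
      rw [map_add, map_add]
      exact add_le_add_left hβ.2 _
    exact this hv

/-- Smaller monomials reduce to elements of `B` below `δ`, so a reduction of `x^δ` to them would be
a nontrivial relation in `⟨x^B⟩ ∩ I`. -/
theorem monomial_notMem_sup_of_forall (m : MonomialOrder (Fin n))
    {I : Ideal (MvPolynomial (Fin n) K)} {B : Set (Expo n)}
    (h : ∀ α, monomial α (1 : K) ∈ I.restrictScalars K ⊔ monomialSpan K {β ∈ B | β ≼[m] α})
    (hI : ∀ f ∈ monomialSpan K B, f ∈ I → f = 0) {δ : Expo n} (hδ : δ ∈ B) :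
    monomial δ (1 : K) ∉ I.restrictScalars K ⊔ monomialSpan K {α | α ≺[m] δ} := by
  intro hmem
  have hle : monomialSpan K {α | α ≺[m] δ} ≤
      I.restrictScalars K ⊔ monomialSpan K {β ∈ B | β ≺[m] δ} := by
    refine monomialSpan_le fun α hα => ?_
    exact sup_monomialSpan_mono _ (fun β hβ => And.intro hβ.1 (lt_of_le_of_lt hβ.2 hα)) (h α)
  obtain ⟨f, hf, v, hv, hfv⟩ := Submodule.mem_sup.1 (sup_le le_sup_left hle hmem)
  have hzero : monomial δ (1 : K) - v = 0 := by
    refine hI _ (sub_mem (monomial_mem_monomialSpan hδ)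
      (monomialSpan_mono (fun β hβ => hβ.1) hv)) ?_
    rw [← hfv, add_sub_cancel_right]
    exact hf
  have hsupp := mem_monomialSpan.1 hv
  rw [← sub_eq_zero.1 hzero] at hsupp
  have : δ ∈ (monomial δ (1 : K)).support := by simp
  exact lt_irrefl _ (hsupp this).2

/-! ### Projections -/

theorem proj_nil (σ : Expo n → K) (f : MvPolynomial (Fin n) K) : proj σ f [] = f := rfl

theorem proj_cons (σ : Expo n → K) (f : MvPolynomial (Fin n) K)
    (x : MvPolynomial (Fin n) K × MvPolynomial (Fin n) K)
    (L : List (MvPolynomial (Fin n) K × MvPolynomial (Fin n) K)) :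
    proj σ f (x :: L) = proj σ (f - hankel σ f x.2 • x.1) L := rfl

/-- `proj` as a linear map. -/
def projLin (σ : Expo n → K) : List (MvPolynomial (Fin n) K × MvPolynomial (Fin n) K) →
    (MvPolynomial (Fin n) K →ₗ[K] MvPolynomial (Fin n) K)
  | [] => LinearMap.id
  | x :: L => projLin σ L ∘ₗ (LinearMap.id - ((hankel σ).flip x.2).smulRight x.1)

theorem projLin_apply (σ : Expo n → K)
    (L : List (MvPolynomial (Fin n) K × MvPolynomial (Fin n) K)) (f : MvPolynomial (Fin n) K) :
    projLin σ L f = proj σ f L := by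
  induction L generalizing f with
  | nil => rfl
  | cons x L ih => exact ih _

theorem sub_proj_mem {σ : Expo n → K} {W : Submodule K (MvPolynomial (Fin n) K)}
    {L : List (MvPolynomial (Fin n) K × MvPolynomial (Fin n) K)} (h : ∀ x ∈ L, x.1 ∈ W)
    (f : MvPolynomial (Fin n) K) : f - proj σ f L ∈ W := by
  induction L generalizing f with
  | nil => simp [proj_nil]
  | cons x L ih =>
    rw [proj_cons]
    have h1 := ih (fun y hy => h y (List.mem_cons_of_mem _ hy)) (f - hankel σ f x.2 • x.1)
    have h2 := W.smul_mem (hankel σ f x.2) (h x List.mem_cons_self)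
    convert W.add_mem h1 h2 using 1
    abel

theorem proj_eq_self {σ : Expo n → K}
    {L : List (MvPolynomial (Fin n) K × MvPolynomial (Fin n) K)} {f : MvPolynomial (Fin n) K}
    (h : ∀ x ∈ L, hankel σ f x.2 = 0) : proj σ f L = f := by
  induction L with
  | nil => rfl
  | cons x L ih =>
    rw [proj_cons, h x List.mem_cons_self, zero_smul, sub_zero]
    exact ih fun y hy => h y (List.mem_cons_of_mem _ hy)

theorem hankel_proj_of_forall {σ : Expo n → K}
    {L : List (MvPolynomial (Fin n) K × MvPolynomial (Fin n) K)} {f q : MvPolynomial (Fin n) K}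
    (hf : hankel σ f q = 0) (h : ∀ x ∈ L, hankel σ x.1 q = 0) : hankel σ (proj σ f L) q = 0 := by
  induction L generalizing f with
  | nil => exact hf
  | cons x L ih =>
    rw [proj_cons]
    refine ih ?_ fun y hy => h y (List.mem_cons_of_mem _ hy)
    rw [map_sub, map_smul, LinearMap.sub_apply, LinearMap.smul_apply, hf, h x List.mem_cons_self,
      smul_zero, sub_zero]

/-- Each step kills the pairing with its own `m_i`, and triangularity keeps the later steps from
reviving it. -/
theorem hankel_proj {σ : Expo n → K}
    {L : List (MvPolynomial (Fin n) K × MvPolynomial (Fin n) K)}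
    (hL : L.Pairwise fun x y => hankel σ y.1 x.2 = 0) (h1 : ∀ x ∈ L, hankel σ x.1 x.2 = 1)
    (f : MvPolynomial (Fin n) K) : ∀ x ∈ L, hankel σ (proj σ f L) x.2 = 0 := by
  induction L generalizing f with
  | nil => simp
  | cons x L ih =>
    rw [List.pairwise_cons] at hL
    intro y hy
    rw [proj_cons]
    rcases List.mem_cons.1 hy with rfl | hy
    · refine hankel_proj_of_forall ?_ hL.1
      rw [map_sub, map_smul, LinearMap.sub_apply, LinearMap.smul_apply, h1 y List.mem_cons_self,
        smul_eq_mul, mul_one, sub_self]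
    · exact ih hL.2 (fun z hz => h1 z (List.mem_cons_of_mem _ hz)) _ y hy

/-- The steps before its own leave `p_i` untouched; its own step subtracts `p_i` itself. -/
theorem proj_fst_eq_zero {σ : Expo n → K}
    {L : List (MvPolynomial (Fin n) K × MvPolynomial (Fin n) K)}
    (hL : L.Pairwise fun x y => hankel σ y.1 x.2 = 0) (h1 : ∀ x ∈ L, hankel σ x.1 x.2 = 1) :
    ∀ x ∈ L, proj σ x.1 L = 0 := by
  induction L with
  | nil => simp
  | cons x L ih =>
    rw [List.pairwise_cons] at hL
    intro y hy
    rw [proj_cons]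
    rcases List.mem_cons.1 hy with rfl | hy
    · rw [h1 y List.mem_cons_self, one_smul, sub_self, ← projLin_apply, map_zero]
    · rw [hL.1 y hy, zero_smul, sub_zero]
      exact ih hL.2 (fun z hz => h1 z (List.mem_cons_of_mem _ hz)) y hy

/-- Elimination with the pivots of `L`, from the last to the first. -/
theorem exists_sub_mem_forall_hankel_eq_zero {σ : Expo n → K} (m : MonomialOrder (Fin n))
    {γ₀ : Expo n} {L : List (MvPolynomial (Fin n) K × Expo n)}
    (hL : L.Pairwise fun x y => hankel σ y.1 (monomial x.2 1) = 0)
    (h1 : ∀ x ∈ L, hankel σ x.1 (monomial x.2 1) ≠ 0)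
    (hmin : ∀ x ∈ L, γ₀ ≺[m] x.2 → hankel σ x.1 (monomial γ₀ 1) = 0)
    (hmin' : ∀ x ∈ L, ∀ y ∈ L, y.2 ≺[m] x.2 → hankel σ x.1 (monomial y.2 1) = 0)
    (hγ₀ : ∀ x ∈ L, x.2 ≠ γ₀) :
    ∃ g, g - monomial γ₀ 1 ∈ monomialSpan K {γ | (∃ x ∈ L, x.2 = γ) ∧ γ ≺[m] γ₀} ∧
      ∀ x ∈ L, hankel σ x.1 g = 0 := by
  induction L with
  | nil => exact ⟨monomial γ₀ 1, by simp, by simp⟩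
  | cons x L ih =>
    rw [List.pairwise_cons] at hL
    obtain ⟨g, hg, hLg⟩ := ih hL.2 (fun y hy => h1 y (List.mem_cons_of_mem _ hy))
      (fun y hy => hmin y (List.mem_cons_of_mem _ hy))
      (fun y hy z hz => hmin' y (List.mem_cons_of_mem _ hy) z (List.mem_cons_of_mem _ hz))
      (fun y hy => hγ₀ y (List.mem_cons_of_mem _ hy))
    have hsub : monomialSpan K {γ | (∃ x ∈ L, x.2 = γ) ∧ γ ≺[m] γ₀} ≤
        monomialSpan K {γ | (∃ y ∈ x :: L, y.2 = γ) ∧ γ ≺[m] γ₀} :=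
      monomialSpan_mono fun γ ⟨⟨y, hy, hyγ⟩, hγ⟩ => ⟨⟨y, List.mem_cons_of_mem _ hy, hyγ⟩, hγ⟩
    rcases lt_or_gt_of_ne (fun h => hγ₀ x List.mem_cons_self (m.toSyn.injective h)) with hlt | hgt
    -- This correction does not disturb the later equations, since the later polynomials vanish on
    -- the pivot `x.2`.
    · refine ⟨g - (hankel σ x.1 g / hankel σ x.1 (monomial x.2 1)) • monomial x.2 1, ?_, ?_⟩
      · rw [sub_right_comm]
        exact sub_mem (hsub hg) (Submodule.smul_mem _ _ (monomial_mem_monomialSpan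
          ⟨⟨x, List.mem_cons_self, rfl⟩, hlt⟩))
      · intro y hy
        rw [map_sub, map_smul, smul_eq_mul]
        rcases List.mem_cons.1 hy with rfl | hy
        · rw [div_mul_cancel₀ _ (h1 y List.mem_cons_self), sub_self]
        · rw [hLg y hy, hL.1 y hy, mul_zero, sub_zero]
    -- Nothing to correct: all exponents of `g` are `γ₀` or pivots below it, hence below `x.2`,
    -- where `x.1` vanishes by minimality.
    · refine ⟨g, hsub hg, fun y hy => ?_⟩
      rcases List.mem_cons.1 hy with rfl | hy
      · rw [← sub_add_cancel g (monomial γ₀ 1), map_add, hmin y List.mem_cons_self hgt, add_zero]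
        refine hankel_eq_zero_of_mem_monomialSpan hg ?_
        rintro _ ⟨⟨z, hz, rfl⟩, hzγ⟩
        exact hmin' y List.mem_cons_self z (List.mem_cons_of_mem _ hz) (hzγ.trans hgt)
      · exact hLg y hy

/-! ### Triangular pivots on a flat truncation -/

/-- The properties of the output of the algorithm that the flat extension depends on: the `p_β`,
`β ∈ b`, and the pivots `c` are in triangular duality, each pivot is the smallest possible in `B'`,
and the border relations vanish on `x^(B')`. -/
structure IsFlatPivoting (σ : Expo n → K) (m : MonomialOrder (Fin n)) (B' : Set (Expo n))
    (b c d : List (Expo n)) (p : Expo n → MvPolynomial (Fin n) K) : Prop where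
  nodup : b.Nodup
  length_eq : b.length = c.length
  connected : ConnectedToOne {β | β ∈ b}
  connected' : ConnectedToOne B'
  plus_subset : plus {γ | γ ∈ c} ⊆ B'
  d_eq : {α | α ∈ d} = border {β | β ∈ b}
  pivot : ∀ x ∈ b.zip c, hankel σ (p x.1) (monomial x.2 1) ≠ 0
  pivot_min : ∀ x ∈ b.zip c, ∀ γ ∈ B', γ ≺[m] x.2 → hankel σ (p x.1) (monomial γ 1) = 0
  triangular : (b.zip c).Pairwise fun x y => hankel σ (p y.1) (monomial x.2 1) = 0
  lead : ∀ α, α ∈ b ∨ α ∈ d → p α - monomial α 1 ∈ monomialSpan K {β | β ∈ b ∧ β ≺[m] α}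
  relation : ∀ α ∈ d, ∀ γ ∈ B', hankel σ (p α) (monomial γ 1) = 0

theorem exists_mem_zip_left {α β : Type*} {l : List α} {l' : List β} (h : l.length = l'.length)
    {x : α} (hx : x ∈ l) : ∃ y, (x, y) ∈ l.zip l' := by
  rw [← List.map_fst_zip h.le] at hx
  obtain ⟨⟨x, y⟩, hxy, rfl⟩ := List.mem_map.1 hx
  exact ⟨y, hxy⟩

theorem exists_mem_zip_right {α β : Type*} {l : List α} {l' : List β} (h : l.length = l'.length)
    {y : β} (hy : y ∈ l') : ∃ x, (x, y) ∈ l.zip l' := by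
  rw [← List.map_snd_zip h.ge] at hy
  obtain ⟨⟨x, y⟩, hxy, rfl⟩ := List.mem_map.1 hy
  exact ⟨x, hxy⟩

/-- The pairs `(p_β, m_β)`. -/
def pivotPairs (σ : Expo n → K) (p : Expo n → MvPolynomial (Fin n) K)
    (L : List (Expo n × Expo n)) : List (MvPolynomial (Fin n) K × MvPolynomial (Fin n) K) :=
  L.map fun x => (p x.1, (hankel σ (p x.1) (monomial x.2 1))⁻¹ • monomial x.2 1)

theorem pivotPairs_pairwise {σ : Expo n → K} {p : Expo n → MvPolynomial (Fin n) K}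
    {L : List (Expo n × Expo n)}
    (h : L.Pairwise fun x y => hankel σ (p y.1) (monomial x.2 1) = 0) :
    (pivotPairs σ p L).Pairwise fun x y => hankel σ y.1 x.2 = 0 := by
  rw [pivotPairs, List.pairwise_map]
  refine h.imp fun hxy => ?_
  rw [map_smul, hxy, smul_zero]

theorem pivotPairs_eq_one {σ : Expo n → K} {p : Expo n → MvPolynomial (Fin n) K}
    {L : List (Expo n × Expo n)} (h : ∀ x ∈ L, hankel σ (p x.1) (monomial x.2 1) ≠ 0) :
    ∀ x ∈ pivotPairs σ p L, hankel σ x.1 x.2 = 1 := by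
  intro x hx
  obtain ⟨y, hy, rfl⟩ := List.mem_map.1 hx
  rw [map_smul, smul_eq_mul, inv_mul_cancel₀ (h y hy)]

theorem hankel_proj_pivotPairs {σ : Expo n → K} {p : Expo n → MvPolynomial (Fin n) K}
    {L : List (Expo n × Expo n)}
    (hL : L.Pairwise fun x y => hankel σ (p y.1) (monomial x.2 1) = 0)
    (h : ∀ x ∈ L, hankel σ (p x.1) (monomial x.2 1) ≠ 0) (f : MvPolynomial (Fin n) K) :
    ∀ x ∈ L, hankel σ (proj σ f (pivotPairs σ p L)) (monomial x.2 1) = 0 := by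
  intro x hx
  have := hankel_proj (pivotPairs_pairwise hL) (pivotPairs_eq_one h) f _
    (List.mem_map_of_mem hx)
  rw [map_smul, smul_eq_mul] at this
  exact (mul_eq_zero.1 this).resolve_left (inv_ne_zero (h x hx))

namespace IsFlatPivoting

variable {σ : Expo n → K} {m : MonomialOrder (Fin n)} {B' : Set (Expo n)} {b c d : List (Expo n)}
  {p : Expo n → MvPolynomial (Fin n) K}

theorem p_mem (h : IsFlatPivoting σ m B' b c d p) {β : Expo n} (hβ : β ∈ b) :
    p β ∈ monomialSpan K {β | β ∈ b} := by
  rw [← sub_add_cancel (p β) (monomial β 1)]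
  exact add_mem (monomialSpan_mono (fun α hα => hα.1) (h.lead β (Or.inl hβ)))
    (monomial_mem_monomialSpan hβ)

theorem p_mem_plus (h : IsFlatPivoting σ m B' b c d p) {α : Expo n} (hα : α ∈ d) :
    p α ∈ monomialSpan K (plus {β | β ∈ b}) := by
  rw [← sub_add_cancel (p α) (monomial α 1)]
  refine add_mem (monomialSpan_mono (fun α hα => subset_plus _ hα.1) (h.lead α (Or.inr hα)))
    (monomial_mem_monomialSpan ?_)
  have : α ∈ border {β | β ∈ b} := h.d_eq ▸ hα
  exact this.1

theorem c_subset (h : IsFlatPivoting σ m B' b c d p) {γ : Expo n} (hγ : γ ∈ c) : γ ∈ B' :=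
  h.plus_subset (subset_plus _ hγ)

theorem monomialSpan_le_of_p_mem (h : IsFlatPivoting σ m B' b c d p)
    {W : Submodule K (MvPolynomial (Fin n) K)} (hW : ∀ β ∈ b, p β ∈ W) :
    monomialSpan K {β | β ∈ b} ≤ W := by
  refine monomialSpan_le fun β => ?_
  induction hs : m.toSyn β using WellFoundedLT.induction generalizing β with
  | _ s ih =>
    intro hβ
    rw [← sub_sub_cancel (p β) (monomial β 1)]
    refine sub_mem (hW β hβ) (monomialSpan_le (W := W) ?_ (h.lead β (Or.inl hβ)))
    exact fun α hα => ih _ (hs ▸ hα.2) α rfl hα.1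

theorem proj_eq_zero (h : IsFlatPivoting σ m B' b c d p) {f : MvPolynomial (Fin n) K}
    (hf : f ∈ monomialSpan K {β | β ∈ b}) : proj σ f (pivotPairs σ p (b.zip c)) = 0 := by
  have : monomialSpan K {β | β ∈ b} ≤ LinearMap.ker (projLin σ (pivotPairs σ p (b.zip c))) := by
    refine h.monomialSpan_le_of_p_mem fun β hβ => ?_
    obtain ⟨γ, hγ⟩ := exists_mem_zip_left h.length_eq hβ
    rw [LinearMap.mem_ker, projLin_apply]
    exact proj_fst_eq_zero (pivotPairs_pairwise h.triangular) (pivotPairs_eq_one h.pivot) _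
      (List.mem_map_of_mem hγ)
  rw [← projLin_apply]
  exact this hf

theorem proj_eq_self_of_forall (f : MvPolynomial (Fin n) K)
    (hf : ∀ γ ∈ c, hankel σ f (monomial γ 1) = 0) :
    proj σ f (pivotPairs σ p (b.zip c)) = f := by
  refine proj_eq_self fun x hx => ?_
  obtain ⟨⟨β, γ⟩, hy, rfl⟩ := List.mem_map.1 hx
  rw [map_smul, hf _ (List.of_mem_zip hy).2, smul_zero]

/-- `proj` fixes `f` by orthogonality to the pivots, and kills it as an element of the span of the
`p β`. -/
theorem eq_zero_of_forall (h : IsFlatPivoting σ m B' b c d p) {f : MvPolynomial (Fin n) K}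
    (hf : f ∈ monomialSpan K {β | β ∈ b}) (hc : ∀ γ ∈ c, hankel σ f (monomial γ 1) = 0) :
    f = 0 := by
  rw [← proj_eq_self_of_forall (p := p) (b := b) f hc, h.proj_eq_zero hf]

theorem exists_extension (h : IsFlatPivoting σ m B' b c d p) :
    ∃ τ : Expo n → K,
      (∀ f ∈ monomialSpan K (plus {β | β ∈ b}), ∀ γ ∈ B',
        hankel τ f (monomial γ 1) = hankel σ f (monomial γ 1)) ∧
      ∀ f, ∃ v ∈ monomialSpan K {β | β ∈ b}, f - v ∈ recIdeal τ := by
  obtain ⟨N, N_apply⟩ : ∃ N : MvPolynomial (Fin n) K →ₗ[K] MvPolynomial (Fin n) K,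
      ∀ f, N f = f - proj σ f (pivotPairs σ p (b.zip c)) :=
    ⟨LinearMap.id - projLin σ (pivotPairs σ p (b.zip c)), fun f => by
      rw [LinearMap.sub_apply, LinearMap.id_apply, projLin_apply]⟩
  have hN_mem : ∀ f, N f ∈ monomialSpan K {β | β ∈ b} := by
    intro f
    rw [N_apply]
    refine sub_proj_mem (fun x hx => ?_) f
    obtain ⟨⟨β, γ⟩, hy, rfl⟩ := List.mem_map.1 hx
    exact h.p_mem (List.of_mem_zip hy).1
  have hN_id : ∀ f ∈ monomialSpan K {β | β ∈ b}, N f = f := by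
    intro f hf
    rw [N_apply, h.proj_eq_zero hf, sub_zero]
  refine exists_flat_extension h.connected h.connected' h.plus_subset
    N hN_mem hN_id ?_ fun f => h.eq_zero_of_forall
  intro f hf γ hγ
  have hle : monomialSpan K (plus {β | β ∈ b}) ≤
      LinearMap.eqLocus ((hankel σ).flip (monomial γ 1) ∘ₗ N)
        ((hankel σ).flip (monomial γ 1)) := by
    refine monomialSpan_le fun α hα => ?_
    rw [LinearMap.mem_eqLocus, LinearMap.comp_apply, LinearMap.flip_apply, LinearMap.flip_apply]
    rcases mem_or_mem_border_of_mem_plus hα with hα | hα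
    · rw [hN_id _ (monomial_mem_monomialSpan hα)]
    · have hαd : α ∈ d := by
        rw [← h.d_eq] at hα
        exact hα
      obtain ⟨v, hv, hα'⟩ : ∃ v ∈ monomialSpan K {β | β ∈ b}, monomial α 1 = p α - v :=
        ⟨p α - monomial α 1, monomialSpan_mono (fun β hβ => hβ.1) (h.lead α (Or.inr hαd)),
          (sub_sub_cancel _ _).symm⟩
      -- On the border, `x^α` is `p α` minus an element of `⟨x^b⟩`; `N` kills the former, which
      -- pairs to zero with `x^(B')`, and fixes the latter.
      have h0 : N (p α) = 0 := by
        rw [N_apply, proj_eq_self_of_forall _ fun γ hγ => h.relation α hαd γ (h.c_subset hγ), sub_self]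
      rw [hα', map_sub, h0, hN_id _ hv, map_sub, map_sub,
        LinearMap.sub_apply, LinearMap.sub_apply, map_zero, LinearMap.zero_apply,
        h.relation α hαd γ hγ]
  have hNf := hle hf
  rwa [LinearMap.mem_eqLocus, LinearMap.comp_apply, LinearMap.flip_apply, LinearMap.flip_apply]
    at hNf

/-! ### Reduction modulo the recurrence ideal of a flat extension -/

variable {τ : Expo n → K}

theorem eq_zero_of_mem_recIdeal (h : IsFlatPivoting σ m B' b c d p)
    (hτ : ∀ f ∈ monomialSpan K (plus {β | β ∈ b}), ∀ γ ∈ B',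
      hankel τ f (monomial γ 1) = hankel σ f (monomial γ 1))
    {f : MvPolynomial (Fin n) K} (hf : f ∈ monomialSpan K {β | β ∈ b}) (hI : f ∈ recIdeal τ) :
    f = 0 := by
  refine h.eq_zero_of_forall hf fun γ hγ => ?_
  rw [← hτ f (monomialSpan_mono (subset_plus _) hf) γ (h.c_subset hγ), mem_recIdeal.1 hI,
    LinearMap.zero_apply]

/-- The representative of `p α` in `⟨x^b⟩` modulo `I_τ` is orthogonal to the pivots, as `p α` is, so
it vanishes by nondegeneracy. -/
theorem p_mem_recIdeal (h : IsFlatPivoting σ m B' b c d p)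
    (hτ : ∀ f ∈ monomialSpan K (plus {β | β ∈ b}), ∀ γ ∈ B',
      hankel τ f (monomial γ 1) = hankel σ f (monomial γ 1))
    (hV : ∀ f, ∃ v ∈ monomialSpan K {β | β ∈ b}, f - v ∈ recIdeal τ)
    {α : Expo n} (hα : α ∈ d) : p α ∈ recIdeal τ := by
  obtain ⟨v, hv, hI⟩ := hV (p α)
  have : v = 0 := by
    refine h.eq_zero_of_forall hv fun γ hγ => ?_
    rw [← hτ v (monomialSpan_mono (subset_plus _) hv) γ (h.c_subset hγ),
      ← h.relation α hα γ (h.c_subset hγ), ← hτ _ (h.p_mem_plus hα) γ (h.c_subset hγ)]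
    rw [mem_recIdeal, map_sub, sub_eq_zero] at hI
    rw [hI]
  rwa [this, sub_zero] at hI

/-- The ideal is left arbitrary so that two extensions can be compared through the intersection of
their recurrence ideals. -/
theorem monomial_mem_sup (h : IsFlatPivoting σ m B' b c d p)
    {I : Ideal (MvPolynomial (Fin n) K)} (hI : ∀ α ∈ d, p α ∈ I) (α : Expo n) :
    monomial α (1 : K) ∈ I.restrictScalars K ⊔ monomialSpan K {β | β ∈ b ∧ β ≼[m] α} := by
  refine monomial_mem_sup_of_forall_plus m (B := {β | β ∈ b}) (Submodule.mem_sup_right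
    (monomial_mem_monomialSpan ⟨h.connected.1, le_rfl⟩)) (fun α hα => ?_) α
  rcases mem_or_mem_border_of_mem_plus hα with hα | hα
  · exact Submodule.mem_sup_right (monomial_mem_monomialSpan ⟨hα, le_rfl⟩)
  · rw [← h.d_eq] at hα
    rw [← sub_sub_cancel (p α) (monomial α 1)]
    exact sub_mem (Submodule.mem_sup_left (hI α hα)) (Submodule.mem_sup_right
      (monomialSpan_mono (fun β hβ => And.intro hβ.1 hβ.2.le) (h.lead α (Or.inr hα))))

theorem monomial_notMem_sup (h : IsFlatPivoting σ m B' b c d p)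
    (hτ : ∀ f ∈ monomialSpan K (plus {β | β ∈ b}), ∀ γ ∈ B',
      hankel τ f (monomial γ 1) = hankel σ f (monomial γ 1))
    (hV : ∀ f, ∃ v ∈ monomialSpan K {β | β ∈ b}, f - v ∈ recIdeal τ)
    {δ : Expo n} (hδ : δ ∈ b) :
    monomial δ (1 : K) ∉ (recIdeal τ).restrictScalars K ⊔ monomialSpan K {α | α ≺[m] δ} :=
  monomial_notMem_sup_of_forall m (B := {β | β ∈ b})
    (h.monomial_mem_sup fun _ hα => h.p_mem_recIdeal hτ hV hα)
    (fun _ hf hI => h.eq_zero_of_mem_recIdeal hτ hf hI) hδ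

/-- The monomials of `B'` reduce to smaller monomials of `c`. -/
theorem monomial_mem_sup_pivots (h : IsFlatPivoting σ m B' b c d p)
    (hτ : ∀ f ∈ monomialSpan K (plus {β | β ∈ b}), ∀ γ ∈ B',
      hankel τ f (monomial γ 1) = hankel σ f (monomial γ 1))
    (hV : ∀ f, ∃ v ∈ monomialSpan K {β | β ∈ b}, f - v ∈ recIdeal τ)
    {γ₀ : Expo n} (hγ₀ : γ₀ ∈ B') :
    monomial γ₀ (1 : K) ∈
      (recIdeal τ).restrictScalars K ⊔ monomialSpan K {γ | γ ∈ c ∧ γ ≼[m] γ₀} := by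
  by_cases hc : γ₀ ∈ c
  · exact Submodule.mem_sup_right (monomial_mem_monomialSpan ⟨hc, le_rfl⟩)
  have hmap : ∀ x ∈ (b.zip c).map fun x => (p x.1, x.2), ∃ y ∈ b.zip c, (p y.1, y.2) = x :=
    fun x hx => List.mem_map.1 hx
  have hτ' : ∀ β ∈ b, ∀ γ ∈ B', hankel τ (p β) (monomial γ 1) = hankel σ (p β) (monomial γ 1) :=
    fun β hβ => hτ _ (monomialSpan_mono (subset_plus _) (h.p_mem hβ))
  obtain ⟨g, hg, hpg⟩ := exists_sub_mem_forall_hankel_eq_zero (σ := τ) m (γ₀ := γ₀)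
    (L := (b.zip c).map fun x => (p x.1, x.2)) (by
      rw [List.pairwise_map]
      refine h.triangular.imp_of_mem fun {x y} hx hy hxy => ?_
      rw [hτ' _ (List.of_mem_zip hy).1 _ (h.c_subset (List.of_mem_zip hx).2), hxy]) (by
      intro x hx
      obtain ⟨y, hy, rfl⟩ := hmap x hx
      rw [hτ' _ (List.of_mem_zip hy).1 _ (h.c_subset (List.of_mem_zip hy).2)]
      exact h.pivot y hy) (by
      intro x hx
      obtain ⟨y, hy, rfl⟩ := hmap x hx
      rw [hτ' _ (List.of_mem_zip hy).1 _ hγ₀]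
      exact h.pivot_min y hy _ hγ₀) (by
      intro x hx z hz
      obtain ⟨y, hy, rfl⟩ := hmap x hx
      obtain ⟨w, hw, rfl⟩ := hmap z hz
      have := h.c_subset (List.of_mem_zip hw).2
      rw [hτ' _ (List.of_mem_zip hy).1 _ this]
      exact h.pivot_min y hy _ this) (by
      intro x hx
      obtain ⟨y, hy, rfl⟩ := hmap x hx
      rintro rfl
      exact hc (List.of_mem_zip hy).2)
  -- By symmetry of the Hankel form it suffices that `g` is orthogonal to `⟨x^b⟩`, which together
  -- with `I_τ` spans everything.
  have hgI : g ∈ recIdeal τ := by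
    refine mem_recIdeal.2 (LinearMap.ext fun f => ?_)
    obtain ⟨v, hv, hI⟩ := hV f
    rw [mem_recIdeal, map_sub, sub_eq_zero] at hI
    rw [hankel_comm, hI, LinearMap.zero_apply]
    have : monomialSpan K {β | β ∈ b} ≤ LinearMap.ker ((hankel τ).flip g) := by
      refine h.monomialSpan_le_of_p_mem fun β hβ => ?_
      obtain ⟨γ, hγ⟩ := exists_mem_zip_left h.length_eq hβ
      rw [LinearMap.mem_ker, LinearMap.flip_apply]
      exact hpg (p β, γ) (List.mem_map.2 ⟨(β, γ), hγ, rfl⟩)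
    have hvg := this hv
    rwa [LinearMap.mem_ker, LinearMap.flip_apply] at hvg
  rw [← sub_sub_cancel g (monomial γ₀ 1)]
  refine sub_mem (Submodule.mem_sup_left hgI) (Submodule.mem_sup_right (monomialSpan_mono ?_ hg))
  rintro γ ⟨⟨x, hx, rfl⟩, hγ⟩
  obtain ⟨y, hy, rfl⟩ := hmap x hx
  exact ⟨(List.of_mem_zip hy).2, hγ.le⟩

theorem b_eq_c (h : IsFlatPivoting σ m B' b c d p) : {β | β ∈ b} = {γ | γ ∈ c} := by
  classical
  obtain ⟨τ, hτ, hV⟩ := h.exists_extension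
  have hc : ∀ α, monomial α (1 : K) ∈
      (recIdeal τ).restrictScalars K ⊔ monomialSpan K {γ | γ ∈ c ∧ γ ≼[m] α} := fun α =>
    monomial_mem_sup_of_forall_plus m (B := {γ | γ ∈ c})
      (h.monomial_mem_sup_pivots hτ hV h.connected'.1)
      (fun α hα => h.monomial_mem_sup_pivots hτ hV (h.plus_subset hα)) α
  have hsub : b ⊆ c := by
    intro β hβ
    by_contra hβc
    refine h.monomial_notMem_sup hτ hV hβ (sup_monomialSpan_mono _ (fun γ hγ => ?_) (hc β))
    refine lt_of_le_of_ne hγ.2 fun heq => hβc ?_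
    exact m.toSyn.injective heq ▸ hγ.1
  have hsub' : b.toFinset ⊆ c.toFinset := fun x hx =>
    List.mem_toFinset.2 (hsub (List.mem_toFinset.1 hx))
  have := Finset.eq_of_subset_of_card_le hsub' (by
    rw [List.toFinset_card_of_nodup h.nodup, h.length_eq]
    exact c.toFinset_card_le)
  ext x
  simpa using Finset.ext_iff.1 this x

/-- Modulo `I_τ ∩ I_τ'` every monomial is congruent to an element of `⟨x^b⟩`, where both forms agree
with `σ`. -/
theorem eq_of_extension (h : IsFlatPivoting σ m B' b c d p) {τ' : Expo n → K}
    (hτ : ∀ f ∈ monomialSpan K (plus {β | β ∈ b}), ∀ γ ∈ B',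
      hankel τ f (monomial γ 1) = hankel σ f (monomial γ 1))
    (hV : ∀ f, ∃ v ∈ monomialSpan K {β | β ∈ b}, f - v ∈ recIdeal τ)
    (hτ' : ∀ f ∈ monomialSpan K (plus {β | β ∈ b}), ∀ γ ∈ B',
      hankel τ' f (monomial γ 1) = hankel σ f (monomial γ 1))
    (hV' : ∀ f, ∃ v ∈ monomialSpan K {β | β ∈ b}, f - v ∈ recIdeal τ') : τ = τ' := by
  funext α
  obtain ⟨f, hf, v, hv, hfv⟩ := Submodule.mem_sup.1 (h.monomial_mem_sup
    (I := recIdeal τ ⊓ recIdeal τ')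
    (fun α hα => ⟨h.p_mem_recIdeal hτ hV hα, h.p_mem_recIdeal hτ' hV' hα⟩) α)
  have hv' := monomialSpan_mono (fun β hβ => subset_plus {β | β ∈ b} hβ.1) hv
  have h1 := hτ v hv' 0 h.connected'.1
  have h2 := hτ' v hv' 0 h.connected'.1
  have hf1 := LinearMap.congr_fun (mem_recIdeal.1 hf.1) (monomial 0 1)
  have hf2 := LinearMap.congr_fun (mem_recIdeal.1 hf.2) (monomial 0 1)
  have key : ∀ ρ : Expo n → K, ρ α = hankel ρ (f + v) (monomial 0 1) := fun ρ => by
    rw [hfv, hankel_apply, monomial_mul, add_zero, mul_one, pairing_monomial]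
  rw [key τ, key τ', map_add, map_add, LinearMap.add_apply, LinearMap.add_apply, h1, h2, hf1, hf2]

/-- A path of unit steps from `0 ∈ b` to `δ` must leave `b`, and it does so through the border. -/
theorem exists_mem_le_of_notMem (h : IsFlatPivoting σ m B' b c d p) (δ : Expo n) (hδ : δ ∉ b) :
    ∃ α ∈ d, α ≤ δ := by
  induction δ using expo_induction with
  | zero => exact absurd h.connected.1 hδ
  | add_single δ i ih =>
    by_cases hδb : δ ∈ b
    · have : δ + Finsupp.single i 1 ∈ border {β | β ∈ b} :=
        ⟨add_single_mem_plus (A := {β | β ∈ b}) hδb i, hδ⟩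
      rw [← h.d_eq] at this
      exact ⟨_, this, le_rfl⟩
    · obtain ⟨α, hα, hle⟩ := ih hδb
      exact ⟨α, hα, hle.trans le_self_add⟩

theorem leadingTerm_p (h : IsFlatPivoting σ m B' b c d p) {α : Expo n} (hα : α ∈ d) :
    m.leadingTerm (p α) = monomial α 1 := by
  classical
  have hsupp := mem_monomialSpan.1 (h.lead α (Or.inr hα))
  have hcoeff : ∀ δ, ¬ δ ≺[m] α → (p α).coeff δ = (monomial α (1 : K)).coeff δ := by
    intro δ hδ
    rw [← sub_eq_zero, ← coeff_sub]
    by_contra h0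
    exact hδ (hsupp (mem_support_iff.2 h0)).2
  have h1 : (p α).coeff α = 1 := by rw [hcoeff α (lt_irrefl _), coeff_monomial, if_pos rfl]
  have hdeg : m.degree (p α) = α := by
    refine m.toSyn.injective (le_antisymm (m.degree_le_iff.2 fun δ hδ => ?_)
      (m.le_degree (mem_support_iff.2 (h1 ▸ one_ne_zero))))
    by_contra hlt
    rw [mem_support_iff, hcoeff δ fun h' => hlt h'.le, coeff_monomial] at hδ
    exact hlt (by rw [of_not_not fun hne => hδ (if_neg hne)])
  rw [MonomialOrder.leadingTerm, MonomialOrder.leadingCoeff, hdeg, h1]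

theorem isGroebnerBasis (h : IsFlatPivoting σ m B' b c d p)
    (hτ : ∀ f ∈ monomialSpan K (plus {β | β ∈ b}), ∀ γ ∈ B',
      hankel τ f (monomial γ 1) = hankel σ f (monomial γ 1))
    (hV : ∀ f, ∃ v ∈ monomialSpan K {β | β ∈ b}, f - v ∈ recIdeal τ) :
    IsGroebnerBasis m {f | f ∈ d.map p} (recIdeal τ) := by
  have hsub : {f | f ∈ d.map p} ⊆ (recIdeal τ : Set (MvPolynomial (Fin n) K)) := by
    intro f hf
    obtain ⟨α, hα, rfl⟩ := List.mem_map.1 hf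
    exact h.p_mem_recIdeal hτ hV hα
  refine ⟨hsub, le_antisymm (Ideal.span_mono (Set.image_mono hsub)) (Ideal.span_le.2 ?_)⟩
  rintro _ ⟨f, hf, rfl⟩
  by_cases hf0 : f = 0
  · rw [hf0, MonomialOrder.leadingTerm_zero]
    exact zero_mem _
  have hlc : m.leadingCoeff f ≠ 0 := m.leadingCoeff_ne_zero_iff.2 hf0
  have hb : m.degree f ∉ b := by
    -- Otherwise `f` would rewrite the standard monomial `x^(deg f)` into strictly smaller ones.
    intro hb
    refine h.monomial_notMem_sup hτ hV hb ?_
    have hrest : m.leadingTerm f - f ∈ monomialSpan K {α | α ≺[m] m.degree f} := by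
      rw [mem_monomialSpan]
      intro δ hδ
      rw [Finset.mem_coe, mem_support_iff, coeff_sub, MonomialOrder.leadingTerm] at hδ
      by_cases hδf : δ = m.degree f
      · subst hδf
        simp [MonomialOrder.leadingCoeff] at hδ
      · rw [coeff_monomial, if_neg (Ne.symm hδf), zero_sub, neg_ne_zero] at hδ
        exact lt_of_le_of_ne (m.le_degree (mem_support_iff.2 hδ))
          fun h' => hδf (m.toSyn.injective h')
    have hlt : monomial (m.degree f) (1 : K) = (m.leadingCoeff f)⁻¹ • m.leadingTerm f := by
      rw [MonomialOrder.leadingTerm, smul_monomial, smul_eq_mul, inv_mul_cancel₀ hlc]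
    rw [hlt, ← add_sub_cancel f (m.leadingTerm f)]
    exact Submodule.smul_mem _ _ (add_mem (Submodule.mem_sup_left hf)
      (Submodule.mem_sup_right hrest))
  obtain ⟨α, hα, hle⟩ := h.exists_mem_le_of_notMem _ hb
  have : m.leadingTerm f = monomial (m.degree f - α) (m.leadingCoeff f) * m.leadingTerm (p α) := by
    rw [h.leadingTerm_p hα, monomial_mul, mul_one, tsub_add_cancel_of_le hle,
      MonomialOrder.leadingTerm]
  rw [this]
  exact Ideal.mul_mem_left _ _ (Ideal.subset_span ⟨p α, List.mem_map_of_mem hα, rfl⟩)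

end IsFlatPivoting

/-! ### Invariants of the algorithm -/

/-- The invariant of the inner loop. -/
structure IsPivotState (σ : Expo n → K) (a : List (Expo n)) (m : MonomialOrder (Fin n))
    (S : State n K) : Prop where
  mem_treated : ∀ α, α ∈ S.treated ↔ α ∈ S.b ∨ α ∈ S.d
  nodup : S.b.Nodup
  length_eq : S.b.length = S.c.length
  m_eq : ∀ x ∈ S.b.zip S.c,
    S.m x.1 = (hankel σ (S.p x.1) (monomial x.2 1))⁻¹ • monomial x.2 1
  pivot : ∀ x ∈ S.b.zip S.c, hankel σ (S.p x.1) (monomial x.2 1) ≠ 0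
  pivot_min : ∀ x ∈ S.b.zip S.c, ∀ γ ∈ a, γ ≺[m] x.2 →
    monomial γ 1 * S.p x.1 ∈ monomialSpan K {α | α ∈ a} → hankel σ (S.p x.1) (monomial γ 1) = 0
  triangular : (S.b.zip S.c).Pairwise fun x y => hankel σ (S.p y.1) (monomial x.2 1) = 0
  lead : ∀ α ∈ S.treated, S.p α - monomial α 1 ∈ monomialSpan K {β | β ∈ S.b ∧ β ≺[m] α}
  relation : ∀ α ∈ S.d, ∀ γ ∈ a, monomial γ 1 * S.p α ∈ monomialSpan K {α | α ∈ a} →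
    hankel σ (S.p α) (monomial γ 1) = 0
  sublist : S.t.Sublist a
  cover : ∀ γ ∈ a, γ ∈ S.t ∨ γ ∈ S.c
  connected : ∀ β ∈ S.b, β ≠ 0 → ∃ β' ∈ S.b, ∃ i : Fin n, β = β' + Finsupp.single i 1

theorem isPivotState_init (σ : Expo n → K) (a : List (Expo n)) (m : MonomialOrder (Fin n)) :
    IsPivotState σ a m (init a : State n K) where
  mem_treated := by simp [init]
  nodup := by simp [init]
  length_eq := by simp [init]
  m_eq := by simp [init]
  pivot := by simp [init]
  pivot_min := by simp [init]
  triangular := by simp [init]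
  lead := by simp [init]
  relation := by simp [init]
  sublist := List.Sublist.refl a
  cover := by simp [init]
  connected := by simp [init]

open scoped Classical in
theorem firstPivot_eq_none {σ : Expo n → K} {a t : List (Expo n)} {p : MvPolynomial (Fin n) K}
    (h : firstPivot σ a t p = none) {γ : Expo n} (hγ : γ ∈ t)
    (hp : monomial γ 1 * p ∈ monomialSpan K {α | α ∈ a}) : hankel σ p (monomial γ 1) = 0 := by
  have := List.find?_eq_none.1 h γ hγ
  rw [decide_eq_true_eq] at this
  exact of_not_not fun hne => this ⟨hp, hne⟩

-- The list `t` is increasing, so the first admissible exponent is also the smallest.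
open scoped Classical in
theorem firstPivot_eq_some {σ : Expo n → K} {a t : List (Expo n)} {p : MvPolynomial (Fin n) K}
    {m : MonomialOrder (Fin n)} (ht : t.Pairwise fun α β => α ≺[m] β) {γ : Expo n}
    (h : firstPivot σ a t p = some γ) :
    γ ∈ t ∧ hankel σ p (monomial γ 1) ≠ 0 ∧ ∀ γ' ∈ t, γ' ≺[m] γ →
      monomial γ' 1 * p ∈ monomialSpan K {α | α ∈ a} → hankel σ p (monomial γ' 1) = 0 := by
  obtain ⟨h1, as, bs, rfl, has⟩ := List.find?_eq_some_iff_append.1 h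
  rw [decide_eq_true_eq] at h1
  refine ⟨by simp, h1.2, fun γ' hγ' hlt hp => ?_⟩
  rcases List.mem_append.1 hγ' with hγ' | hγ'
  · have := has γ' hγ'
    rw [Bool.not_eq_true', decide_eq_false_iff_not] at this
    exact of_not_not fun hne => this ⟨hp, hne⟩
  · rcases List.mem_cons.1 hγ' with rfl | hγ'
    · exact absurd hlt (lt_irrefl _)
    · have := (List.pairwise_cons.1 (List.pairwise_append.1 ht).2.1).1 γ' hγ'
      exact absurd hlt this.not_gt

namespace IsPivotState

variable {σ : Expo n → K} {a : List (Expo n)} {m : MonomialOrder (Fin n)} {S : State n K}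

theorem map_eq_pivotPairs (h : IsPivotState σ a m S) :
    (S.b.map fun β => (S.p β, S.m β)) = pivotPairs σ S.p (S.b.zip S.c) := by
  conv_lhs => rw [← List.map_fst_zip h.length_eq.le, List.map_map]
  refine List.map_congr_left fun x hx => ?_
  rw [Function.comp_apply, h.m_eq x hx]

theorem treat (h : IsPivotState σ a m S) (ha : a.Pairwise fun α β => α ≺[m] β) {α : Expo n}
    (hα : ∀ β ∈ S.treated, β ≺[m] α)
    (hconn : α = 0 ∨ ∃ β' ∈ S.b, ∃ i : Fin n, α = β' + Finsupp.single i 1) :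
    IsPivotState σ a m (treat σ a S α) := by
  classical
  have hαt : α ∉ S.treated := fun h' => lt_irrefl _ (hα α h')
  have hb : ∀ β ∈ S.b, β ∈ S.treated := fun β hβ => (h.mem_treated β).2 (Or.inl hβ)
  have hd : ∀ β ∈ S.d, β ∈ S.treated := fun β hβ => (h.mem_treated β).2 (Or.inr hβ)
  have hne : ∀ β ∈ S.treated, β ≠ α := fun β hβ h' => hαt (h' ▸ hβ)
  obtain ⟨q, hq⟩ : ∃ q, proj σ (monomial α 1) (S.b.map fun β => (S.p β, S.m β)) = q := ⟨_, rfl⟩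
  -- An exponent of `a` missing from `t` is an old pivot, to which `q` is orthogonal; so searching
  -- `t` loses nothing against searching `a`.
  have hqc : ∀ γ ∈ S.c, hankel σ q (monomial γ 1) = 0 := by
    intro γ hγ
    obtain ⟨β, hβ⟩ := exists_mem_zip_right h.length_eq hγ
    rw [← hq, h.map_eq_pivotPairs]
    exact hankel_proj_pivotPairs h.triangular h.pivot (monomial α 1) (β, γ) hβ
  have hlead : q - monomial α 1 ∈ monomialSpan K {β | β ∈ S.b ∧ β ≺[m] α} := by
    rw [← neg_mem_iff, neg_sub, ← hq]
    refine sub_proj_mem (fun x hx => ?_) _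
    obtain ⟨β, hβ, rfl⟩ := List.mem_map.1 hx
    have h1 := h.lead β (hb β hβ)
    have h2 := monomialSpan_mono (K := K) (B := {β | β ∈ S.b ∧ β ≺[m] α})
      (fun δ hδ => ⟨hδ.1, hα δ (hb δ hδ.1)⟩) h1
    rw [← sub_add_cancel (S.p β) (monomial β 1)]
    exact add_mem h2 (monomial_mem_monomialSpan ⟨hβ, hα β (hb β hβ)⟩)
  have hp : ∀ β ∈ S.treated, Function.update S.p α q β = S.p β := fun β hβ =>
    Function.update_of_ne (hne β hβ) _ _
  have hpz : ∀ x ∈ S.b.zip S.c, Function.update S.p α q x.1 = S.p x.1 := fun x hx =>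
    hp _ (hb _ (List.of_mem_zip hx).1)
  have hpα : Function.update S.p α q α = q := Function.update_self _ _ _
  have ht := ha.sublist h.sublist
  rw [HankelBB.treat, hq]
  split
  next γ hγ =>
    obtain ⟨hγt, hγ0, hγmin⟩ := firstPivot_eq_some ht hγ
    have hzip : (S.b ++ [α]).zip (S.c ++ [γ]) = S.b.zip S.c ++ [(α, γ)] := by
      rw [List.zip_append h.length_eq]
      rfl
    have hzmem : ∀ P : Expo n × Expo n → Prop, (∀ x ∈ S.b.zip S.c, P x) → P (α, γ) →
        ∀ x ∈ S.b.zip S.c ++ [(α, γ)], P x := by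
      intro P h1 h2 x hx
      rcases List.mem_append.1 hx with hx | hx
      · exact h1 x hx
      · rw [List.mem_singleton.1 hx]
        exact h2
    constructor <;> dsimp only <;> try rw [hzip]
    · intro β
      simp only [List.mem_append, List.mem_singleton, h.mem_treated]
      tauto
    · exact List.nodup_append.2 ⟨h.nodup, List.nodup_singleton α, fun β hβ δ hδ => by
        rw [List.mem_singleton.1 hδ]
        exact hne β (hb β hβ)⟩
    · simp [h.length_eq]
    · refine hzmem _ (fun x hx => ?_) ?_
      · rw [Function.update_of_ne (hne _ (hb _ (List.of_mem_zip hx).1)), hpz x hx, h.m_eq x hx]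
      · rw [Function.update_self, hpα]
        rfl
    · refine hzmem _ (fun x hx => ?_) ?_
      · rw [hpz x hx]
        exact h.pivot x hx
      · rw [hpα]
        exact hγ0
    · refine hzmem _ (fun x hx => ?_) ?_
      · rw [hpz x hx]
        exact h.pivot_min x hx
      · rw [hpα]
        intro δ hδ hlt hspan
        rcases h.cover δ hδ with hδ | hδ
        · exact hγmin δ hδ hlt hspan
        · exact hqc δ hδ
    · refine List.pairwise_append.2 ⟨h.triangular.imp_of_mem fun {x y} _ hy hxy => ?_,
        List.pairwise_singleton _ _, fun x hx y hy => ?_⟩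
      · rw [hpz y hy, hxy]
      · rw [List.mem_singleton.1 hy, hpα]
        exact hqc _ (List.of_mem_zip hx).2
    · intro β hβ
      have hsub : ∀ δ : Expo n, {β | β ∈ S.b ∧ β ≺[m] δ} ⊆ {β | β ∈ S.b ++ [α] ∧ β ≺[m] δ} :=
        fun δ β hβ => ⟨List.mem_append_left _ hβ.1, hβ.2⟩
      rcases List.mem_append.1 hβ with hβ | hβ
      · rw [hp β hβ]
        exact monomialSpan_mono (hsub β) (h.lead β hβ)
      · rw [List.mem_singleton.1 hβ, hpα]
        exact monomialSpan_mono (hsub α) hlead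
    · intro β hβ
      rw [hp β (hd β hβ)]
      exact h.relation β hβ
    · exact List.erase_sublist.trans h.sublist
    · intro δ hδ
      by_cases hδγ : δ = γ
      · exact Or.inr (by simp [hδγ])
      · exact (h.cover δ hδ).imp (fun h' => (List.mem_erase_of_ne hδγ).2 h')
          fun h' => List.mem_append_left _ h'
    · intro β hβ h0
      rcases List.mem_append.1 hβ with hβ | hβ
      · obtain ⟨β', hβ', i, hi⟩ := h.connected β hβ h0
        exact ⟨β', List.mem_append_left _ hβ', i, hi⟩
      · rw [List.mem_singleton] at hβ
        subst hβ
        obtain ⟨β', hβ', i, hi⟩ := hconn.resolve_left h0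
        exact ⟨β', List.mem_append_left _ hβ', i, hi⟩
  next hnone =>
    constructor <;> dsimp only
    · intro β
      simp only [List.mem_append, List.mem_singleton, h.mem_treated]
      tauto
    · exact h.nodup
    · exact h.length_eq
    · intro x hx
      rw [hpz x hx, h.m_eq x hx]
    · intro x hx
      rw [hpz x hx]
      exact h.pivot x hx
    · intro x hx
      rw [hpz x hx]
      exact h.pivot_min x hx
    · exact h.triangular.imp_of_mem fun {x y} _ hy hxy => by rw [hpz y hy, hxy]
    · intro β hβ
      rcases List.mem_append.1 hβ with hβ | hβ
      · rw [hp β hβ]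
        exact h.lead β hβ
      · rw [List.mem_singleton.1 hβ, hpα]
        exact hlead
    · intro β hβ
      rcases List.mem_append.1 hβ with hβ | hβ
      · rw [hp β (hd β hβ)]
        exact h.relation β hβ
      · rw [List.mem_singleton.1 hβ, hpα]
        intro δ hδ hspan
        rcases h.cover δ hδ with hδ | hδ
        · exact firstPivot_eq_none hnone hδ hspan
        · exact hqc δ hδ
    · exact h.sublist
    · exact h.cover
    · exact h.connected

end IsPivotState

theorem treated_treat (σ : Expo n → K) (a : List (Expo n)) (S : State n K) (α : Expo n) :
    (treat σ a S α).treated = S.treated ++ [α] := by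
  rw [treat]
  split <;> rfl

theorem mem_b_treat {σ : Expo n → K} {a : List (Expo n)} {S : State n K} {α β : Expo n}
    (h : β ∈ S.b) : β ∈ (treat σ a S α).b := by
  rw [treat]
  split
  · exact List.mem_append_left _ h
  · exact h

theorem treated_foldl_treat (σ : Expo n → K) (a l : List (Expo n)) (S : State n K) :
    (l.foldl (treat σ a) S).treated = S.treated ++ l := by
  induction l generalizing S with
  | nil => simp
  | cons α l ih => rw [List.foldl_cons, ih, treated_treat, List.append_assoc, List.singleton_append]

theorem IsPivotState.foldl_treat {σ : Expo n → K} {a : List (Expo n)} {m : MonomialOrder (Fin n)}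
    {S : State n K} (ha : a.Pairwise fun α β => α ≺[m] β) (h : IsPivotState σ a m S)
    {l : List (Expo n)} (hl : (S.treated ++ l).Pairwise fun α β => α ≺[m] β)
    (hconn : ∀ α ∈ l, α = 0 ∨ ∃ β' ∈ S.b, ∃ i : Fin n, α = β' + Finsupp.single i 1) :
    IsPivotState σ a m (l.foldl (HankelBB.treat σ a) S) := by
  induction l generalizing S with
  | nil => exact h
  | cons α l ih =>
    refine ih (h.treat ha (fun β hβ => (List.pairwise_append.1 hl).2.2 β hβ α List.mem_cons_self)
      (hconn α List.mem_cons_self)) ?_ fun β hβ => ?_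
    · rwa [treated_treat, List.append_assoc, List.singleton_append]
    · exact (hconn β (List.mem_cons_of_mem _ hβ)).imp_right
        fun ⟨β', hβ', hi⟩ => ⟨β', mem_b_treat hβ', hi⟩

/-- The invariant of the outer loop. -/
structure IsLoopState (σ : Expo n → K) (a : List (Expo n)) (m : MonomialOrder (Fin n))
    (S : State n K) : Prop where
  todo : ∀ α ∈ S.todo, α = 0 ∨ ∃ β' ∈ S.b, ∃ i : Fin n, α = β' + Finsupp.single i 1
  zero_mem : 0 ∈ S.todo ∨ 0 ∈ S.treated
  pivotState : S.treated.Pairwise (fun α β => α ≺[m] β) → IsPivotState σ a m S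

theorem isLoopState_init (σ : Expo n → K) (a : List (Expo n)) (m : MonomialOrder (Fin n)) :
    IsLoopState σ a m (init a : State n K) where
  todo := fun _ hα => Or.inl (List.mem_singleton.1 hα)
  zero_mem := Or.inl (List.mem_singleton.2 rfl)
  pivotState := fun _ => isPivotState_init σ a m

-- The ordering assumption concerns the whole run. The invariant is therefore conditional on it, and
-- a loop passes it down because it only appends to `treated`.
open scoped Classical in
theorem IsLoopState.loop {σ : Expo n → K} {a : List (Expo n)} {m : MonomialOrder (Fin n)}
    {S : State n K} (ha : a.Pairwise fun α β => α ≺[m] β) (h : IsLoopState σ a m S) :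
    IsLoopState σ a m (loop σ a S) where
  todo := by
    intro α hα
    have hα := (List.mem_filter.1 hα).2
    rw [decide_eq_true_eq] at hα
    rcases hα.1 with ⟨hα | ⟨i, β, hβ, hi⟩, hα'⟩
    · exact absurd hα hα'
    · exact Or.inr ⟨β, hβ, i, hi⟩
  zero_mem := by
    refine Or.inr ?_
    change 0 ∈ (S.todo.foldl (treat σ a) S).treated
    rw [treated_foldl_treat, List.mem_append]
    exact h.zero_mem.symm
  pivotState := by
    intro hS
    change (S.todo.foldl (treat σ a) S).treated.Pairwise _ at hS
    rw [treated_foldl_treat] at hS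
    have := (h.pivotState (List.pairwise_append.1 hS).1).foldl_treat ha hS h.todo
    exact { this with }

/-! ### From the final state to a flat pivoting -/

theorem IsOutput.isLoopState {σ : Expo n → K} {a : List (Expo n)} {S : State n K}
    (h : IsOutput σ a S) {m : MonomialOrder (Fin n)} (ha : a.Pairwise fun α β => α ≺[m] β) :
    IsLoopState σ a m S := by
  obtain ⟨h, -⟩ := h
  induction h with
  | refl => exact isLoopState_init σ a m
  | tail _ hstep ih => exact hstep.2 ▸ ih.loop ha

theorem IsOutput.isFlatPivoting {σ : Expo n → K} {a : List (Expo n)} {S : State n K}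
    (hS : IsOutput σ a S) {m : MonomialOrder (Fin n)} (hm : OrderIs m a S)
    (hd : {α | α ∈ S.d} = border {α | α ∈ S.b})
    {b' : Set (Expo n)} (hb' : ConnectedToOne b') (hc : plus {γ | γ ∈ S.c} ⊆ b')
    (hab : plus {β | β ∈ S.b} + b' = {α | α ∈ a}) :
    IsFlatPivoting σ m b' S.b S.c S.d S.p := by
  have hloop := hS.isLoopState hm.1
  have h := hloop.pivotState hm.2
  have h0 : (0 : Expo n) ∈ S.b := by
    have h0 := hloop.zero_mem
    rw [hS.2] at h0
    -- The exponent `0` has been treated, and a border never contains it, so it cannot have gone to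
    -- `d`.
    refine ((h.mem_treated 0).1 (h0.resolve_left List.not_mem_nil)).resolve_right fun h0 => ?_
    have : (0 : Expo n) ∈ border {α | α ∈ S.b} := hd ▸ h0
    exact zero_notMem_border _ this
  have hadd : ∀ α ∈ plus {β | β ∈ S.b}, ∀ γ ∈ b', α + γ ∈ a := by
    intro α hα γ hγ
    have : α + γ ∈ {α | α ∈ a} := hab ▸ Set.add_mem_add hα hγ
    exact this
  have hmem : ∀ γ ∈ b', γ ∈ a := fun γ hγ => by
    simpa using hadd 0 (subset_plus _ h0) γ hγ
  have hplus : ∀ α ∈ S.treated, α ∈ plus {β | β ∈ S.b} := by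
    intro α hα
    rcases (h.mem_treated α).1 hα with hα | hα
    · exact subset_plus _ hα
    · have : α ∈ border {β | β ∈ S.b} := hd ▸ hα
      exact this.1
  -- This discharges the support condition of the pivot search for every `γ ∈ b'`, leaving pure
  -- statements about vanishing.
  have hspan : ∀ α ∈ S.treated, ∀ γ ∈ b', monomial γ 1 * S.p α ∈ monomialSpan K {α | α ∈ a} := by
    intro α hα γ hγ
    refine monomial_mul_mem_monomialSpan (A := plus {β | β ∈ S.b})
      (fun δ hδ => hadd δ hδ γ hγ) ?_
    rw [← sub_add_cancel (S.p α) (monomial α 1)]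
    exact add_mem (monomialSpan_mono (fun β hβ => subset_plus _ hβ.1) (h.lead α hα))
      (monomial_mem_monomialSpan (hplus α hα))
  exact
    { nodup := h.nodup
      length_eq := h.length_eq
      connected := ⟨h0, h.connected⟩
      connected' := hb'
      plus_subset := hc
      d_eq := hd
      pivot := h.pivot
      pivot_min := fun x hx γ hγ hlt => h.pivot_min x hx γ (hmem γ hγ) hlt
        (hspan _ ((h.mem_treated _).2 (Or.inl (List.of_mem_zip hx).1)) γ hγ)
      triangular := h.triangular
      lead := fun α hα => h.lead α ((h.mem_treated α).2 hα)
      relation := fun α hα γ hγ => h.relation α hα γ (hmem γ hγ)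
        (hspan _ ((h.mem_treated _).2 (Or.inr hα)) γ hγ) }

/-- For a flat pivoting, flat extensions are the forms that agree with `σ` on `x^(b⁺) · x^(B')` and for
which `⟨x^b⟩` complements the recurrence ideal. -/
theorem IsFlatPivoting.isFlatExtension_iff {σ : Expo n → K} {m : MonomialOrder (Fin n)}
    {B' : Set (Expo n)} {a b c d : List (Expo n)} {p : Expo n → MvPolynomial (Fin n) K}
    (h : IsFlatPivoting σ m B' b c d p) (hab : plus {β | β ∈ b} + B' = {α | α ∈ a})
    {τ : Expo n → K} :
    IsFlatExtension σ a b.length τ ↔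
      (∀ f ∈ monomialSpan K (plus {β | β ∈ b}), ∀ γ ∈ B',
        hankel τ f (monomial γ 1) = hankel σ f (monomial γ 1)) ∧
      ∀ f, ∃ v ∈ monomialSpan K {β | β ∈ b}, f - v ∈ recIdeal τ := by
  have hiff : (∀ q ∈ monomialSpan K {α | α ∈ a}, pairing τ q = pairing σ q) ↔
      ∀ f ∈ monomialSpan K (plus {β | β ∈ b}), ∀ γ ∈ B',
        hankel τ f (monomial γ 1) = hankel σ f (monomial γ 1) := by
    rw [← hab]
    constructor
    · intro hq f hf γ hγ
      rw [hankel_apply, hankel_apply, mul_comm]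
      exact hq _ (monomial_mul_mem_monomialSpan (fun α hα => Set.add_mem_add hα hγ) hf)
    · intro hf
      have : monomialSpan K (plus {β | β ∈ b} + B') ≤
          LinearMap.eqLocus (pairing τ) (pairing σ) := by
        refine monomialSpan_le ?_
        rintro _ ⟨α, hα, γ, hγ, rfl⟩
        have := hf _ (monomial_mem_monomialSpan hα) γ hγ
        rwa [hankel_apply, hankel_apply, monomial_mul, one_mul] at this
      exact fun q hq => this hq
  rw [IsFlatExtension, hiff]
  exact and_congr_right fun hτ => rank_hankel_eq_iff h.nodup
    fun f hf hI => h.eq_zero_of_mem_recIdeal hτ hf hI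

end HankelBB

end

/-- The Gröbner basis claim is made for every flat extension, so it covers `σ` itself when `H_σ` has
rank `|b|`. -/
theorem mainTheorem2 {n : ℕ} {K : Type*} [Field K] (σ : HankelBB.Expo n → K)
    (a : List (HankelBB.Expo n)) (ha : HankelBB.ConnectedToOne {α | α ∈ a})
    (S : HankelBB.State n K) (hS : HankelBB.IsOutput σ a S)
    (m : MonomialOrder (Fin n)) (hm : HankelBB.OrderIs m a S)
    (hd : {α | α ∈ S.d} = HankelBB.border {α | α ∈ S.b})
    (b' : Set (HankelBB.Expo n)) (hb' : HankelBB.ConnectedToOne b')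
    (hc : HankelBB.plus {γ | γ ∈ S.c} ⊆ b')
    (hab : HankelBB.plus {β | β ∈ S.b} + b' = {α | α ∈ a}) :
    {β | β ∈ S.b} = {γ | γ ∈ S.c} ∧
      (∃! τ : HankelBB.Expo n → K, HankelBB.IsFlatExtension σ a S.b.length τ) ∧
      ∀ τ : HankelBB.Expo n → K, HankelBB.IsFlatExtension σ a S.b.length τ →
        HankelBB.IsGroebnerBasis m {f | f ∈ S.k} (HankelBB.recIdeal τ) := by
  have h := hS.isFlatPivoting hm hd hb' hc hab
  refine ⟨h.b_eq_c, ?_, fun τ hτ => ?_⟩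
  · obtain ⟨τ, hτ⟩ := h.exists_extension
    refine ⟨τ, (h.isFlatExtension_iff hab).2 hτ, fun τ' hτ' => ?_⟩
    have hτ' := (h.isFlatExtension_iff hab).1 hτ'
    exact h.eq_of_extension hτ'.1 hτ'.2 hτ.1 hτ.2
  · have hτ := (h.isFlatExtension_iff hab).1 hτ
    exact h.isGroebnerBasis hτ.1 hτ.2
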